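/- Let $\mathbb H[q_1,q_2]$ be the ring of slice regular polynomials $P(q_1,q_2)=\sum_{n,m} q_1^n q_2^m a_{n,m}$ ($a_{n,m}\in\mathbb H$, finite sum) with the $*$-product, for which $(q_1^nq_2^m a)*(q_1^rq_2^s b)=q_1^{n+r}q_2^{m+s}ab$, and define $\mathbb H[q]$ likewise. Let $\mathcal L(\mathbb H)$ be the skew field of left $*$-quotients $f^{-*}*g$ of slice regular functions on $\mathbb H$ (everywhere convergent series $\sum_n q^n a_n$, with the $*$-product), and for $x\in\mathcal L(\mathbb H)$ let $[x]$ be its class in the abelianization of the multiplicative group, with $[0]$ adjoined as zero. Let $\mathrm{Det}^*_N$ be the Dieudonné determinant of $N\times N$ matrices over $\mathcal L(\mathbb H)$ (equal to $[0]$ on non-invertible matrices). Let $P,Q\in\mathbb H[q_1,q_2]$. Writing $P=\sum_{k=0}^n q_1^kP_k(q_2)$ and $Q=\sum_{k=0}^m q_1^kQ_k(q_2)$ with $n=\deg_{q_1}P$, $m=\deg_{q_1}Q$ (the degree of the zero polynomial being $0$), let $\mathrm{Res}(P,Q;q_1):=\mathrm{Det}^*_{n+m}(A(q_2))$, where $A$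 is the Sylvester matrix whose first $m$ columns are the successive downward shifts of $(P_0,\dots,P_n,0,\dots,0)^t$ and whose last $n$ columns are those of $(Q_0,\dots,Q_m,0,\dots,0)^t$. Define $\mathrm{Res}(P,Q;q_2)$ in the same way, writing $P$ and $Q$ as polynomials in $q_2$ with coefficients in $\mathbb H[q_1]$. A polynomial representative of such a resultant is an $R\in\mathbb H[q]$ whose class $[R]$ is the resultant. Suppose that $\deg_{q_1}P+\deg_{q_1}Q\ge 1$. Then $\mathrm{Res}(P,Q;q_1)$ has a polynomial representative $R$ with $R(b)=0$ for every common zero $(a,b)\in\mathbb H^2$ of $P$ and $Q$ with $ab=ba$. Moreover, for every such common zero $(a,b)$, every polynomial representative of $\mathrm{Res}(P,Q;q_1)$ vanishes at some conjugate $ubu^{-1}$ of $b$, $u\in\mathbb H\setminus\{0\}$. Suppose that $\deg_{q_2}P+\deg_{q_2}Q\ge 1$. Then $\mathrm{Res}(P,Q;q_2)$ has a polynomial representative $R$ with $R(a)=0$ for every common zero $(a,b)\in\mathbb H^2$ of $P$ and $Q$ with $ab=ba$. Moreover, for every such common zero $(a,b)$, every polynomial representative of $\mathrm{Res}(P,Q;q_2)$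 vanishes at some conjugate $uau^{-1}$ of $a$, $u\in\mathbb H\setminus\{0\}$. -/

import Mathlib

open Polynomial Quaternion

noncomputable section

namespace SliceRegular

/-! ### Entire slice regular functions of one quaternionic variable -/

/-- The regular conjugate `f^c = ∑ qⁿ (conj aₙ)` of `f = ∑ qⁿ aₙ`. -/
def regConj (f : PowerSeries ℍ[ℝ]) : PowerSeries ℍ[ℝ] :=
  PowerSeries.mk fun n => star (PowerSeries.coeff n f)

theorem regConj_mul (f g : PowerSeries ℍ[ℝ]) :
    regConj (f * g) = regConj g * regConj f := by
  ext1 n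
  simp only [regConj, PowerSeries.coeff_mk, PowerSeries.coeff_mul, star_sum, star_mul]
  rw [← Finset.Nat.sum_antidiagonal_swap]
  rfl

theorem regConj_regConj (f : PowerSeries ℍ[ℝ]) : regConj (regConj f) = f := by
  ext1 n
  simp [regConj]

/-- A power series with real coefficients commutes with every power series. -/
theorem mul_comm_of_regConj_eq {s : PowerSeries ℍ[ℝ]} (hs : regConj s = s)
    (f : PowerSeries ℍ[ℝ]) : s * f = f * s := by
  have h : ∀ n (a : ℍ[ℝ]), PowerSeries.coeff n s * a = a * PowerSeries.coeff n s := by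
    intro n a
    have h1 : star (PowerSeries.coeff n s) = PowerSeries.coeff n s := by
      conv_rhs => rw [← hs]
      simp [regConj]
    rw [Quaternion.star_eq_self.mp h1]
    exact Quaternion.coe_commutes _ a
  ext1 n
  simp only [PowerSeries.coeff_mul]
  rw [← Finset.Nat.sum_antidiagonal_swap]
  exact Finset.sum_congr rfl fun p _ => h _ _

theorem norm_term_mul (x y : ℍ[ℝ]) (q : ℍ[ℝ]) (i j : ℕ) :
    ‖q ^ (i + j) * (x * y)‖ = ‖q ^ i * x‖ * ‖q ^ j * y‖ := by
  rw [norm_mul, norm_mul, norm_mul, norm_mul, norm_pow, norm_pow, norm_pow, pow_add]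
  ring

theorem summable_antidiagonal (u v : ℕ → ℝ) (hu : Summable u) (hv : Summable v) (u0 : ∀ n, 0 ≤ u n) (v0 : ∀ n, 0 ≤ v n) :
    Summable fun n => ∑ p ∈ Finset.HasAntidiagonal.antidiagonal n, u p.1 * v p.2 :=
  summable_sum_mul_antidiagonal_of_summable_mul (Summable.mul_of_nonneg hu hv u0 v0)

theorem summable_pow_mul_antidiagonal (a b : ℕ → ℍ[ℝ]) (q : ℍ[ℝ])
    (hf' : Summable fun n => ‖q ^ n * a n‖)
    (hg' : Summable fun n => ‖q ^ n * b n‖)  :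
    Summable fun n => q ^ n * ∑ p ∈ Finset.HasAntidiagonal.antidiagonal n, a p.1 * b p.2 := by
  have h2 := summable_antidiagonal _ _ hf' hg' (fun _ => norm_nonneg _) (fun _ => norm_nonneg _)
  refine Summable.of_norm_bounded h2 fun n => ?_
  rw [Finset.mul_sum]
  refine (norm_sum_le _ _).trans (Finset.sum_le_sum fun p hp => ?_)
  rw [← Finset.HasAntidiagonal.mem_antidiagonal.mp hp]
  exact (norm_term_mul _ _ _ _ _).le

theorem summable_mul (f g : PowerSeries ℍ[ℝ])
    (hf : ∀ q : ℍ[ℝ], Summable fun n => q ^ n * PowerSeries.coeff n f)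
    (hg : ∀ q : ℍ[ℝ], Summable fun n => q ^ n * PowerSeries.coeff n g) (q : ℍ[ℝ]) :
    Summable fun n => q ^ n * PowerSeries.coeff n (f * g) := by
  have := summable_pow_mul_antidiagonal (fun n => PowerSeries.coeff n f)
    (fun n => PowerSeries.coeff n g) q (hf q).norm (hg q).norm
  simpa only [PowerSeries.coeff_mul] using this

/-- The ring `SR(ℍ)` of slice regular functions on the whole of `ℍ`: the power series
`∑ qⁿ aₙ` that converge at every `q ∈ ℍ`. The multiplication of formal power series
(in which the variable commutes with the coefficients) is the `*`-product. -/
def SR : Subring (PowerSeries ℍ[ℝ]) where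
  carrier := {f | ∀ q : ℍ[ℝ], Summable fun n => q ^ n * PowerSeries.coeff n f}
  zero_mem' := fun q => by simp
  one_mem' := fun q => by
    refine summable_of_ne_finset_zero (s := {0}) fun n hn => ?_
    have : n ≠ 0 := by simpa using hn
    simp [PowerSeries.coeff_one, this]
  add_mem' := fun {f g} hf hg q => by
    simpa [mul_add] using (hf q).add (hg q)
  neg_mem' := fun {f} hf q => by
    simpa using (hf q).neg
  mul_mem' := fun {f g} hf hg q => summable_mul f g hf hg q

theorem regConj_mem {f : PowerSeries ℍ[ℝ]} (hf : f ∈ SR) : regConj f ∈ SR := fun q => by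
  rw [← summable_norm_iff]
  have := summable_norm_iff.mpr (hf q)
  simpa [regConj] using this

theorem regConj_ne_zero {f : PowerSeries ℍ[ℝ]} (hf : f ≠ 0) : regConj f ≠ 0 := fun h => hf <| by
  rw [← regConj_regConj f, h]
  ext1 n
  simp [regConj]

/-- The regular conjugate on `SR(ℍ)`. -/
def conjSR (f : SR) : SR := ⟨regConj f.1, regConj_mem f.2⟩

theorem conjSR_ne_zero {f : SR} (hf : f ≠ 0) : conjSR f ≠ 0 := fun h =>
  regConj_ne_zero (fun h0 => hf (Subtype.ext h0)) (congrArg Subtype.val h)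

/-- The symmetrization `fˢ = f^c * f` commutes with every `g`. -/
theorem symm_mul_comm (f g : SR) : conjSR f * f * g = g * (conjSR f * f) := by
  have h : regConj (regConj f.1 * f.1) = regConj f.1 * f.1 := by
    rw [regConj_mul, regConj_regConj]
  exact Subtype.ext (mul_comm_of_regConj_eq h g.1)

/-- The Ore condition: for `r` and `s ≠ 0` one has `sˢ * r = (r * s^c) * s`. -/
theorem ore_condition (r : SR) (s : nonZeroDivisors SR) :
    ∃ (r' : SR) (s' : nonZeroDivisors SR), (s' : SR) * r = r' * s := by
  have hs : s.1 ≠ 0 := nonZeroDivisors.ne_zero s.2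
  have hm : conjSR s.1 * s.1 ≠ 0 := mul_ne_zero (conjSR_ne_zero hs) hs
  have key : conjSR s.1 * s.1 * r = r * conjSR s.1 * s.1 := by
    rw [symm_mul_comm, mul_assoc]
  exact ⟨r * conjSR s.1, ⟨conjSR s.1 * s.1, mem_nonZeroDivisors_of_ne_zero hm⟩, key⟩

instance instOreSet : OreLocalization.OreSet (nonZeroDivisors SR) :=
  (OreLocalization.nonempty_oreSet_iff_of_noZeroDivisors.mpr ore_condition).some

/-- The skew field `L(ℍ)` of semi-regular functions on `ℍ`: the left `*`-quotients
`f^{-*} * g` of slice regular functions `f ≢ 0`, `g` on `ℍ`. -/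
abbrev L : Type := OreLocalization (nonZeroDivisors SR) SR

/-- A slice regular polynomial in one variable `∑ qⁿ aₙ`, as a slice regular function on `ℍ`.
The multiplication of `ℍ[ℝ][X]` (in which `X` commutes with the coefficients)
is the `*`-product. -/
def polyToSR (R : ℍ[ℝ][X]) : SR :=
  ⟨PowerSeries.mk fun n => R.coeff n, fun q => by
    refine summable_of_ne_finset_zero (s := R.support) fun n hn => ?_
    simp [Polynomial.notMem_support_iff.mp hn]⟩

/-- The inclusion of `ℍ[q]` in `L(ℍ)`. -/
def polyToL (R : ℍ[ℝ][X]) : L := OreLocalization.numeratorHom (polyToSR R)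

/-! ### The Dieudonné determinant -/

/-- The maximal abelian quotient of the multiplicative group of a skew field `F`, with a zero
adjoined as the class of `0`. -/
abbrev AbQuot (F : Type*) [DivisionRing F] : Type _ := WithZero (Abelianization Fˣ)

/-- The class `[x]` of an element of a skew field. -/
def cls {F : Type*} [DivisionRing F] (x : F) : AbQuot F :=
  open Classical in
  if h : x = 0 then 0 else ((Abelianization.of (Units.mk0 x h) : Abelianization Fˣ) : WithZero _)

/-- The Dieudonné determinant of a square matrix over a skew field `F`, by elimination: if the
first column vanishes, the determinant is `0`; otherwise a non-zero entry `a_{k0}` of the first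
column is chosen, a left multiple of the `k`-th row is subtracted from every other row to clear
the first column, and one multiplies the class of `(-1)^k a_{k0}` with the determinant of what is
left when the `k`-th row and the first column are removed. The result does not depend on the
chosen rows. (The sign is needed for a general `F`, for instance for a commutative one; over the
skew field of semi-regular functions `-1` is the commutator of `i` and `j`, and the sign
disappears.) -/
def dieudonneDet {F : Type*} [DivisionRing F] :
    (n : ℕ) → Matrix (Fin n) (Fin n) F → AbQuot F
  | 0, _ => 1
  | n + 1, A =>
    open Classical in
    if h : ∃ k, A k 0 ≠ 0 then
      let k := h.choose
      cls ((-1) ^ (k : ℕ) * A k 0) *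
        dieudonneDet n (Matrix.of fun i j =>
          A (k.succAbove i) j.succ - A (k.succAbove i) 0 * (A k 0)⁻¹ * A k j.succ)
    else 0

/-! ### Slice regular polynomials in two variables and their regular resultants

A slice regular polynomial `∑ q₁ⁿ q₂ᵐ a_{n,m}` is an element of `ℍ[ℝ][X][X]`; the outer variable
is `q₁`, the inner one is `q₂`, and `a_{n,m}` is `(P.coeff n).coeff m`. The multiplication of this
ring is the `*`-product. -/

/-- The value `∑ qⁿ aₙ` of a slice regular polynomial in one variable. -/
def evalOne (R : ℍ[ℝ][X]) (q : ℍ[ℝ]) : ℍ[ℝ] :=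
  R.sum fun n a => q ^ n * a

/-- The value `∑ q₁ⁿ q₂ᵐ a_{n,m}` of a slice regular polynomial in two variables. -/
def evalTwo (P : ℍ[ℝ][X][X]) (q₁ q₂ : ℍ[ℝ]) : ℍ[ℝ] :=
  P.sum fun n p => q₁ ^ n * p.sum fun m a => q₂ ^ m * a

/-- The same polynomial written as a polynomial in the (now outer) variable `q₂` with
coefficients in `ℍ[q₁]`. -/
def swapVars (P : ℍ[ℝ][X][X]) : ℍ[ℝ][X][X] :=
  P.sum fun n p => p.sum fun m a => monomial m (monomial n a)

/-- The degree in `q₁`. -/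
def deg₁ (P : ℍ[ℝ][X][X]) : ℕ := P.natDegree

/-- The degree in `q₂`. -/
def deg₂ (P : ℍ[ℝ][X][X]) : ℕ := (swapVars P).natDegree

/-- The regular resultant `Res(P,Q;q₁)`: the Dieudonné determinant over `L(ℍ)` of the Sylvester
matrix of `P` and `Q` as polynomials in `q₁` of degrees `n` and `m`, whose first `m` columns are
the shifts of `(P₀, …, Pₙ)` and whose last `n` columns are the shifts of `(Q₀, …, Qₘ)`. It is an
element of the abelianization of `L(ℍ)`. -/
def res₁ (P Q : ℍ[ℝ][X][X]) : AbQuot L :=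
  dieudonneDet (deg₁ Q + deg₁ P)
    ((Polynomial.sylvester Q P (deg₁ Q) (deg₁ P)).map polyToL)

/-- The regular resultant `Res(P,Q;q₂)`, likewise, with `P` and `Q` as polynomials in `q₂`. -/
def res₂ (P Q : ℍ[ℝ][X][X]) : AbQuot L :=
  dieudonneDet (deg₂ Q + deg₂ P)
    ((Polynomial.sylvester (swapVars Q) (swapVars P) (deg₂ Q) (deg₂ P)).map polyToL)

/-- `R ∈ ℍ[q]` is a polynomial representative of the class `c`; the class determines it
up to commutators only. -/
def IsPolyRep (R : ℍ[ℝ][X]) (c : AbQuot L) : Prop :=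
  cls (polyToL R) = c

/-- `(a, b)` is a common zero of `P` and `Q` with `ab = ba`. -/
def IsCommutingCommonZero (P Q : ℍ[ℝ][X][X]) (a b : ℍ[ℝ]) : Prop :=
  a * b = b * a ∧ evalTwo P a b = 0 ∧ evalTwo Q a b = 0

end SliceRegular

end

open Polynomial Quaternion

noncomputable section

namespace SliceRegular

/-! ### The class map -/

section cls

variable {F : Type*} [DivisionRing F]

/-! Let `(a, b)` be a commuting common zero. Pairing the row `(1, a, a², …)` with a column of the
Sylvester matrix evaluated at `b` gives `aʲ P(a, b)` or `aʲ Q(a, b)`, hence `0`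
(`sum_sylvester_eq_zero`). Since `ab = ba`, the columns of polynomials killed by this pairing form a
right `ℍ[q]`-module (`sum_evalOne_mul_eq_zero`), so right column operations preserve the relation.
The Euclidean algorithm makes the matrix upper triangular by such operations
(`exists_upperTriangular`). They do not change the Dieudonné determinant (`ColOp.dieudonneDet_eq`),
which is therefore the class of the product `R` of the diagonal entries. The first column is now
concentrated in its diagonal entry, so the relation says that this entry vanishes at `b`; zeros of
the leftmost factor persist in a `*`-product, and `R(b) = 0`.

For an arbitrary representative, the symmetrization `f^c * f` is multiplicative with central values,
so its extension to `L` depends only on the class. All representatives thus share one symmetrization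
(`conjPoly_mul_eq_of_cls_eq`), which vanishes at `b`, and this forces a zero at a conjugate of `b`
(`exists_evalOne_conj_eq_zero`). The resultant in `q₂` follows by exchanging the variables, which is
harmless at commuting points.

The determinant is defined through arbitrary pivots, so its invariance is proved by induction on the
size (`invariant_all`). -/

@[simp]
theorem cls_zero : cls (0 : F) = 0 := by simp [cls]

@[simp]
theorem cls_one : cls (1 : F) = 1 := by
  have : Units.mk0 (1 : F) one_ne_zero = 1 := by ext; simp
  simp [cls, this]

theorem cls_ne_zero {x : F} (hx : x ≠ 0) : cls x ≠ 0 := by simp [cls, hx]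

@[simp]
theorem cls_eq_zero {x : F} : cls x = 0 ↔ x = 0 :=
  ⟨fun h => by_contra fun hx => cls_ne_zero hx h, fun h => by simp [h]⟩

theorem cls_mul (x y : F) : cls (x * y) = cls x * cls y := by
  by_cases hx : x = 0
  · simp [hx]
  by_cases hy : y = 0
  · simp [hy]
  have : Units.mk0 (x * y) (mul_ne_zero hx hy) = Units.mk0 x hx * Units.mk0 y hy := by ext; simp
  simp only [cls, hx, hy, mul_ne_zero hx hy, dif_neg, not_false_eq_true, this, map_mul]
  rfl

/-- The class map as a homomorphism. -/
def clsHom (F : Type*) [DivisionRing F] : F →* AbQuot F where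
  toFun := cls
  map_one' := cls_one
  map_mul' := cls_mul

theorem cls_neg_one_pow (h : cls (-1 : F) = 1) (n : ℕ) (x : F) : cls ((-1) ^ n * x) = cls x := by
  have : cls ((-1 : F) ^ n) = 1 := by
    rw [show cls ((-1 : F) ^ n) = clsHom F ((-1) ^ n) from rfl, map_pow]
    simp [clsHom, h]
  rw [cls_mul, this, one_mul]

theorem cls_inv {x : F} (hx : x ≠ 0) : cls x⁻¹ * cls x = 1 := by
  rw [← cls_mul, inv_mul_cancel₀ hx, cls_one]

end cls

/-! ### Invariance of the Dieudonné determinant under row and column operations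

We assume throughout that `-1` is a product of commutators, so that signs do not matter. -/

section det

variable {F : Type*} [DivisionRing F]

/-- The Schur complement of the entry `A k 0`. -/
def schur {n : ℕ} (A : Matrix (Fin (n + 1)) (Fin (n + 1)) F) (k : Fin (n + 1)) :
    Matrix (Fin n) (Fin n) F :=
  Matrix.of fun i j =>
    A (k.succAbove i) j.succ - A (k.succAbove i) 0 * (A k 0)⁻¹ * A k j.succ

theorem dieudonneDet_eq_zero {n : ℕ} {A : Matrix (Fin (n + 1)) (Fin (n + 1)) F}
    (h : ∀ k, A k 0 = 0) : dieudonneDet (n + 1) A = 0 := by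
  rw [dieudonneDet, dif_neg]
  simpa using h

theorem exists_dieudonneDet_eq (h1 : cls (-1 : F) = 1) {n : ℕ}
    {A : Matrix (Fin (n + 1)) (Fin (n + 1)) F} (h : ∃ k, A k 0 ≠ 0) :
    ∃ k, A k 0 ≠ 0 ∧ dieudonneDet (n + 1) A = cls (A k 0) * dieudonneDet n (schur A k) := by
  refine ⟨h.choose, h.choose_spec, ?_⟩
  rw [dieudonneDet, dif_pos h]
  simp only [cls_neg_one_pow h1]
  rfl

theorem exists_perm_succAbove {n : ℕ} {p q : Fin (n + 1)} {σ : Equiv.Perm (Fin (n + 1))}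
    (h : σ p = q) :
    ∃ τ : Equiv.Perm (Fin n), ∀ i, σ (p.succAbove i) = q.succAbove (τ i) := by
  refine ⟨(finSuccAboveEquiv p).trans ((σ.subtypeEquiv fun a => ?_).trans
    (finSuccAboveEquiv q).symm), fun i => ?_⟩
  · rw [← h, not_iff_not]; exact σ.injective.eq_iff.symm
  · have := (finSuccAboveEquiv q).apply_symm_apply
      ⟨σ (p.succAbove i), fun h' => p.succAbove_ne i (σ.injective (h'.trans h.symm))⟩
    rw [finSuccAboveEquiv_apply] at this
    exact (congrArg Subtype.val this).symm

/-- Invariance of the determinant of order `n` under permutations of the rows. -/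
def PermInvariant (F : Type*) [DivisionRing F] (n : ℕ) : Prop :=
  ∀ (A : Matrix (Fin n) (Fin n) F) (σ : Equiv.Perm (Fin n)),
    dieudonneDet n (A.submatrix σ id) = dieudonneDet n A

/-- Behaviour of the determinant of order `n` when multiples of the `p`-th row are added to the
other rows and the `p`-th row is rescaled. -/
def RowInvariant (F : Type*) [DivisionRing F] (n : ℕ) : Prop :=
  ∀ (A B : Matrix (Fin n) (Fin n) F) (p : Fin n) (c : F) (l : Fin n → F), c ≠ 0 →
    (∀ j, A p j = c * B p j) → (∀ i, i ≠ p → ∀ j, A i j = B i j + l i * B p j) →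
    dieudonneDet n A = cls c * dieudonneDet n B

/-- Independence of the determinant of order `n + 1` of the choice of the pivot. -/
def PivotInvariant (F : Type*) [DivisionRing F] (n : ℕ) : Prop :=
  ∀ (A : Matrix (Fin (n + 1)) (Fin (n + 1)) F) (k : Fin (n + 1)), A k 0 ≠ 0 →
    dieudonneDet (n + 1) A = cls (A k 0) * dieudonneDet n (schur A k)

/-- Up to a permutation of rows, the Schur complements at two pivots `k` and `l` differ by a row
operation that rescales one row by `-(A l 0 * (A k 0)⁻¹)`. The class of this factor is what
exchanges `cls (A k 0)` for `cls (A l 0)`. -/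
theorem pivotInvariant_of (h1 : cls (-1 : F) = 1) {n : ℕ} (hP : PermInvariant F n)
    (hR : RowInvariant F n) : PivotInvariant F n := by
  intro A k hk
  obtain ⟨l, hl, e⟩ := exists_dieudonneDet_eq h1 ⟨k, hk⟩
  rw [e]
  by_cases hkl : k = l
  · rw [hkl]
  obtain ⟨τ, hτ⟩ := exists_perm_succAbove (σ := Equiv.swap k l) (Equiv.swap_apply_left k l)
  -- `p` is the position of row `l` once row `k` is deleted; `τ` matches it with row `k` once row
  -- `l` is deleted.
  obtain ⟨p, hp⟩ := Fin.exists_succAbove_eq (Ne.symm hkl)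
  have hτp : l.succAbove (τ p) = k := by rw [← hτ, hp, Equiv.swap_apply_right]
  have hτi : ∀ i, i ≠ p → l.succAbove (τ i) = k.succAbove i := fun i hi => by
    rw [← hτ, Equiv.swap_apply_of_ne_of_ne (k.succAbove_ne i)]
    rw [← hp]
    exact fun h => hi (Fin.succAbove_right_injective h)
  have key := hR (schur A k) ((schur A l).submatrix τ id) p (-(A l 0 * (A k 0)⁻¹))
    (fun i => - (A (k.succAbove i) 0 * (A k 0)⁻¹)) (by simp [hk, hl])
    (fun j => by
      simp only [schur, Matrix.submatrix_apply, Matrix.of_apply, id, hτp, hp]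
      simp only [mul_sub, neg_mul, mul_assoc, inv_mul_cancel_left₀ hk, mul_inv_cancel_left₀ hl]
      abel)
    (fun i hi j => by
      simp only [schur, Matrix.submatrix_apply, Matrix.of_apply, id, hτp, hτi i hi]
      simp only [mul_sub, neg_mul, mul_assoc, inv_mul_cancel_left₀ hk]
      abel)
  rw [key, hP, ← neg_one_mul, cls_mul, h1, cls_mul, one_mul]
  calc _ = (cls (A k 0)⁻¹ * cls (A k 0)) * (cls (A l 0) * dieudonneDet n (schur A l)) := by
        rw [cls_inv hk, one_mul]
    _ = _ := by ac_rfl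

theorem permInvariant_succ {n : ℕ} (hP : PermInvariant F n) (hV : PivotInvariant F n) :
    PermInvariant F (n + 1) := by
  intro A σ
  by_cases h : ∃ k, A k 0 ≠ 0
  · obtain ⟨k, hk⟩ := h
    obtain ⟨τ, hτ⟩ := exists_perm_succAbove (σ := σ) (σ.apply_symm_apply k)
    rw [hV A k hk, hV (A.submatrix σ id) (σ.symm k) (by simpa using hk), ← hP (schur A k) τ]
    simp only [Matrix.submatrix_apply, Equiv.apply_symm_apply, id]
    congr 2
    ext i j
    simp [schur, hτ]
  · push Not at h
    rw [dieudonneDet_eq_zero h, dieudonneDet_eq_zero]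
    exact fun k => h _

/-- If `B p 0 ≠ 0`, pivoting at `p` yields identical Schur complements, and `c` appears in the
pivot. Otherwise any pivot lies in another row, and the Schur complements are again related by a row
operation, of smaller size. -/
theorem rowInvariant_succ {n : ℕ} (hR : RowInvariant F n)
    (hV : PivotInvariant F n) : RowInvariant F (n + 1) := by
  intro A B p c l hc hp hl
  by_cases hpz : B p 0 = 0
  · by_cases h : ∃ k, B k 0 ≠ 0
    · obtain ⟨k, hk⟩ := h
      have hkp : k ≠ p := fun h => hk (h ▸ hpz)
      have hA0 : ∀ i, i ≠ p → A i 0 = B i 0 := fun i hi => by simp [hl i hi, hpz]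
      have hAp : A p 0 = 0 := by simp [hp, hpz]
      have hkA : A k 0 ≠ 0 := by rwa [hA0 k hkp]
      obtain ⟨q, hq⟩ := Fin.exists_succAbove_eq hkp.symm
      rw [hV A k hkA, hV B k hk, hA0 k hkp, hR (schur A k) (schur B k) q c
        (fun i => l (k.succAbove i) - B (k.succAbove i) 0 * (B k 0)⁻¹ * l k) hc]
      · ac_rfl
      · intro j
        simp [schur, hq, hAp, hpz, hp]
      · intro i hi j
        have : k.succAbove i ≠ p := fun h => hi (Fin.succAbove_right_injective (h.trans hq.symm))
        simp only [schur, Matrix.of_apply, hq, hpz, hA0 _ this, hl _ this, hl k hkp]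
        noncomm_ring
    · push Not at h
      rw [dieudonneDet_eq_zero h, dieudonneDet_eq_zero, mul_zero]
      intro k
      by_cases hk : k = p
      · rw [hk, hp, hpz, mul_zero]
      · rw [hl k hk, hpz, h, mul_zero, add_zero]
  · have hA : A p 0 ≠ 0 := by rw [hp]; exact mul_ne_zero hc hpz
    rw [hV A p hA, hV B p hpz, hp, cls_mul, mul_assoc]
    congr 3
    ext i j
    have e (x : F) : (B p 0)⁻¹ * (c⁻¹ * (c * x)) = (B p 0)⁻¹ * x := by
      rw [inv_mul_cancel_left₀ hc]
    simp only [schur, Matrix.of_apply, hp, hl _ (p.succAbove_ne i), mul_inv_rev, mul_assoc, e,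
      add_mul, mul_inv_cancel_left₀ hpz]
    abel

theorem invariant_all (h1 : cls (-1 : F) = 1) (n : ℕ) : PermInvariant F n ∧ RowInvariant F n := by
  induction n with
  | zero => exact ⟨fun _ _ => rfl, fun _ _ p => p.elim0⟩
  | succ n ih =>
    have hV := pivotInvariant_of h1 ih.1 ih.2
    exact ⟨permInvariant_succ ih.1 hV, rowInvariant_succ ih.2 hV⟩

/-- Expansion of the determinant along any pivot of the first column. -/
theorem dieudonneDet_eq_schur (h1 : cls (-1 : F) = 1) {n : ℕ}
    (A : Matrix (Fin (n + 1)) (Fin (n + 1)) F) (k : Fin (n + 1)) (hk : A k 0 ≠ 0) :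
    dieudonneDet (n + 1) A = cls (A k 0) * dieudonneDet n (schur A k) :=
  pivotInvariant_of h1 (invariant_all h1 n).1 (invariant_all h1 n).2 A k hk

/-- Adding multiples of a row to the other rows does not change the determinant. -/
theorem dieudonneDet_addRow (h1 : cls (-1 : F) = 1) {n : ℕ} (A : Matrix (Fin n) (Fin n) F)
    (p : Fin n) (l : Fin n → F) (hl : l p = 0) :
    dieudonneDet n (Matrix.of fun i j => A i j + l i * A p j) = dieudonneDet n A := by
  rw [(invariant_all h1 n).2 _ A p 1 l one_ne_zero (by simp [hl]) (by simp), cls_one, one_mul]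

theorem dieudonneDet_zero_col (h1 : cls (-1 : F) = 1) {n : ℕ} (A : Matrix (Fin n) (Fin n) F)
    (j : Fin n) (hj : ∀ i, A i j = 0) : dieudonneDet n A = 0 := by
  induction n with
  | zero => exact j.elim0
  | succ n ih =>
    by_cases h : ∃ k, A k 0 ≠ 0
    · obtain ⟨k, hk⟩ := h
      rw [dieudonneDet_eq_schur h1 A k hk]
      cases j using Fin.cases with
      | zero => exact (hk (hj k)).elim
      | succ j => rw [ih (schur A k) j fun i => by simp [schur, hj], mul_zero]
    · push Not at h
      exact dieudonneDet_eq_zero h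

/-- The determinant vanishes if the first column and another one are concentrated in the same
row. -/
theorem dieudonneDet_parallel (h1 : cls (-1 : F) = 1) {n : ℕ}
    (A : Matrix (Fin (n + 1)) (Fin (n + 1)) F) (l : Fin (n + 1)) (j : Fin n)
    (h0 : ∀ i, i ≠ l → A i 0 = 0) (hj : ∀ i, i ≠ l → A i j.succ = 0) :
    dieudonneDet (n + 1) A = 0 := by
  by_cases hl : A l 0 = 0
  · exact dieudonneDet_eq_zero fun k => (eq_or_ne k l).elim (fun h => h ▸ hl) (h0 k)
  · rw [dieudonneDet_eq_schur h1 A l hl, dieudonneDet_zero_col h1 _ j, mul_zero]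
    intro i
    simp [schur, h0 _ (l.succAbove_ne i), hj _ (l.succAbove_ne i)]

/-- If the `j`-th column is concentrated in the `l`-th row, then the other entries of that row do
not matter. -/
theorem dieudonneDet_congr_row (h1 : cls (-1 : F) = 1) {n : ℕ} (A B : Matrix (Fin n) (Fin n) F)
    (l j : Fin n) (hA : ∀ i, i ≠ l → A i j = 0) (hlj : A l j = B l j)
    (hAB : ∀ i, i ≠ l → ∀ r, A i r = B i r) : dieudonneDet n A = dieudonneDet n B := by
  induction n with
  | zero => exact j.elim0
  | succ n ih =>
    cases j using Fin.cases with
    | zero =>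
      by_cases hl : A l 0 = 0
      · have h0 : ∀ k, A k 0 = 0 := fun k => (eq_or_ne k l).elim (fun h => h ▸ hl) (hA k)
        rw [dieudonneDet_eq_zero h0, dieudonneDet_eq_zero]
        intro k
        rcases eq_or_ne k l with rfl | hk
        · rw [← hlj, hl]
        · rw [← hAB k hk, h0]
      · rw [dieudonneDet_eq_schur h1 A l hl, dieudonneDet_eq_schur h1 B l (hlj ▸ hl), hlj]
        congr 2
        ext i r
        have h := l.succAbove_ne i
        simp [schur, ← hAB _ h, hA _ h]
    | succ j =>
      by_cases h : ∃ k, k ≠ l ∧ A k 0 ≠ 0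
      · obtain ⟨k, hkl, hk⟩ := h
        obtain ⟨p, hp⟩ := Fin.exists_succAbove_eq hkl.symm
        have hi (i) (hi : i ≠ p) : k.succAbove i ≠ l :=
          fun h => hi (Fin.succAbove_right_injective (h.trans hp.symm))
        rw [dieudonneDet_eq_schur h1 A k hk, dieudonneDet_eq_schur h1 B k (hAB k hkl 0 ▸ hk),
          hAB k hkl 0]
        congr 1
        refine ih _ _ p j (fun i h => ?_) ?_ fun i h r => ?_
        · simp [schur, hA _ hkl, hA _ (hi i h)]
        · simp [schur, hp, hlj, hA _ hkl, ← hAB k hkl]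
        · simp [schur, ← hAB _ hkl, ← hAB _ (hi i h)]
      · push Not at h
        rw [dieudonneDet_parallel h1 A l j h hA, dieudonneDet_parallel h1 B l j]
        · exact fun i hi => by rw [← hAB i hi, h i hi]
        · exact fun i hi => by rw [← hAB i hi, hA i hi]

end det

/-- The matrix `B` arises from `A` by adding a right multiple of one column to another one. -/
def ColOp {n : Type*} {R : Type*} [Semiring R] (A B : Matrix n n R) : Prop :=
  ∃ i j c, i ≠ j ∧ (∀ r, B r i = A r i + A r j * c) ∧ ∀ r s, s ≠ i → B r s = A r s

theorem ColOp.map {n R S : Type*} [Semiring R] [Semiring S] (f : R →+* S) {A B : Matrix n n R}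
    (h : ColOp A B) : ColOp (A.map f) (B.map f) := by
  obtain ⟨i, j, c, hij, h1, h2⟩ := h
  exact ⟨i, j, f c, hij, fun r => by simp [h1], fun r s hs => by simp [h2 r s hs]⟩

/-! ### Invariance under column operations -/

section col

variable {F : Type*} [DivisionRing F]

/-- Row operations multiply on the left and column operations on the right, so they commute: the
same row clearing may be applied to both matrices beforehand. -/
theorem dieudonneDet_colOp_reduce (h1 : cls (-1 : F) = 1) {n : ℕ} {j : Fin n} {c : F}
    {A B : Matrix (Fin (n + 1)) (Fin (n + 1)) F} (p : Fin (n + 1)) (l : Fin (n + 1) → F)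
    (hl : l p = 0) (hi : ∀ r, B r 0 = A r 0 + A r j.succ * c)
    (hs : ∀ r s, s ≠ 0 → B r s = A r s)
    (H : ∀ A' B' : Matrix (Fin (n + 1)) (Fin (n + 1)) F,
      (∀ r s, A' r s = A r s + l r * A p s) →
      (∀ r, B' r 0 = A' r 0 + A' r j.succ * c) → (∀ r s, s ≠ 0 → B' r s = A' r s) →
      dieudonneDet (n + 1) B' = dieudonneDet (n + 1) A') :
    dieudonneDet (n + 1) B = dieudonneDet (n + 1) A := by
  rw [← dieudonneDet_addRow h1 A p l hl, ← dieudonneDet_addRow h1 B p l hl]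
  refine H _ _ (fun _ _ => rfl) (fun r => ?_) fun r s h => ?_
  · simp only [Matrix.of_apply, hi]; noncomm_ring
  · simp [hs _ s h]

theorem dieudonneDet_colOp_zero (h1 : cls (-1 : F) = 1) {n : ℕ} {j : Fin n} {c : F}
    {A B : Matrix (Fin (n + 1)) (Fin (n + 1)) F}
    (hi : ∀ r, B r 0 = A r 0 + A r j.succ * c)
    (hs : ∀ r s, s ≠ 0 → B r s = A r s) :
    dieudonneDet (n + 1) B = dieudonneDet (n + 1) A := by
  by_cases h0 : ∃ k, A k 0 ≠ 0
  · obtain ⟨k, hk⟩ := h0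
    refine dieudonneDet_colOp_reduce h1 k (fun r => if r = k then 0 else - (A r 0 * (A k 0)⁻¹))
      (by simp) hi hs fun A' B' hA' hi hs => ?_
    have hk' : A' k 0 ≠ 0 := by simpa [hA'] using hk
    have hA0 : ∀ r, r ≠ k → A' r 0 = 0 := fun r hr => by simp [hA', hr, hk]
    clear hA'
    -- Column `0` is now concentrated in row `k`. Once column `j.succ` is concentrated in a row `l ≠
    -- k`, the Schur complements at `k` differ only in row `l`, where `dieudonneDet_congr_row`
    -- applies. If there is no such `l`, both determinants vanish.
    by_cases h : ∃ l, l ≠ k ∧ A' l j.succ ≠ 0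
    · obtain ⟨l, hlk, hl⟩ := h
      refine dieudonneDet_colOp_reduce h1 l
        (fun r => if r = l then 0 else - (A' r j.succ * (A' l j.succ)⁻¹))
        (by simp) hi hs fun A B hA hi hs => ?_
      have hAk : A k 0 ≠ 0 := by simpa [hA, hA0 _ hlk] using hk'
      have hA0 : ∀ r, r ≠ k → A r 0 = 0 := fun r hr => by simp [hA, hA0 _ hlk, hA0 r hr]
      have hAj : ∀ r, r ≠ l → A r j.succ = 0 := fun r hr => by simp [hA, hl, hr]
      have hBk : B k 0 = A k 0 := by simp [hi, hAj k hlk.symm]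
      obtain ⟨p, hp⟩ := Fin.exists_succAbove_eq hlk
      have hip (i) (hi : i ≠ p) : k.succAbove i ≠ l :=
          fun h => hi (Fin.succAbove_right_injective (h.trans hp.symm))
      rw [dieudonneDet_eq_schur h1 A k hAk, dieudonneDet_eq_schur h1 B k (hBk ▸ hAk), hBk]
      congr 1
      symm
      refine dieudonneDet_congr_row h1 _ _ p j (fun i h => ?_) ?_ fun i h r => ?_
      · simp [schur, hAj _ hlk.symm, hAj _ (hip i h)]
      · simp [schur, hs, hAj _ hlk.symm]
      · simp [schur, hs, hi, hA0 _ (k.succAbove_ne i), hAj _ (hip i h)]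
    · push Not at h
      rw [dieudonneDet_parallel h1 A' k j hA0 h, dieudonneDet_parallel h1 B' k j]
      · exact fun i hi' => by simp [hi, h _ hi', hA0 _ hi']
      · exact fun i hi' => by simp [hs, h _ hi']
  · push Not at h0
    rw [dieudonneDet_eq_zero h0]
    by_cases h : ∃ k, B k 0 ≠ 0
    · obtain ⟨k, hk⟩ := h
      -- The first column of `B` is column `j.succ` times `c`, so clearing the former also clears
      -- the latter.
      rw [dieudonneDet_eq_schur h1 B k hk, dieudonneDet_zero_col h1 _ j, mul_zero]
      intro i
      have hBk : A k j.succ * c ≠ 0 := by simpa [hi, h0] using hk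
      have hc : c ≠ 0 := right_ne_zero_of_mul hBk
      have hA : A k j.succ ≠ 0 := left_ne_zero_of_mul hBk
      simp [schur, hs, hi, h0, mul_assoc, hc, hA]
    · push Not at h
      exact dieudonneDet_eq_zero h

/-- Adding a right multiple of a column to another one does not change the determinant. -/
theorem ColOp.dieudonneDet_eq (h1 : cls (-1 : F) = 1) {n : ℕ} {A B : Matrix (Fin n) (Fin n) F}
    (h : ColOp A B) : dieudonneDet n B = dieudonneDet n A := by
  induction n with
  | zero => rfl
  | succ n ih =>
    obtain ⟨i, j, c, hij, hi, hs⟩ := h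
    cases i using Fin.cases with
    | zero =>
      obtain ⟨j, rfl⟩ := Fin.exists_succ_eq.mpr hij.symm
      exact dieudonneDet_colOp_zero h1 hi hs
    | succ i =>
      have hB0 : ∀ r, B r 0 = A r 0 := fun r => hs r 0 (Fin.succ_ne_zero i).symm
      by_cases h : ∃ k, A k 0 ≠ 0
      · obtain ⟨k, hk⟩ := h
        rw [dieudonneDet_eq_schur h1 A k hk, dieudonneDet_eq_schur h1 B k (hB0 k ▸ hk), hB0]
        congr 1
        cases j using Fin.cases with
        | zero =>
          congr 1
          ext r s
          rcases eq_or_ne s i with rfl | h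
          · simp only [schur, Matrix.of_apply, hB0, hi, mul_assoc, mul_add,
              inv_mul_cancel_left₀ hk]
            abel
          · simp [schur, hB0, hs, h]
        | succ j =>
          refine ih ⟨i, j, c, fun h => hij (h ▸ rfl), fun r => ?_, fun r s h => ?_⟩
          · simp only [schur, Matrix.of_apply, hB0, hi]
            noncomm_ring
          · simp [schur, hB0, hs, h]
      · push Not at h
        rw [dieudonneDet_eq_zero h, dieudonneDet_eq_zero fun k => (hB0 k).trans (h k)]

/-- The determinant of a triangular matrix. -/
theorem dieudonneDet_of_upperTriangular (h1 : cls (-1 : F) = 1) {n : ℕ}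
    (A : Matrix (Fin n) (Fin n) F) (hA : ∀ i j, j < i → A i j = 0) :
    dieudonneDet n A = ∏ i, cls (A i i) := by
  induction n with
  | zero => simp [dieudonneDet]
  | succ n ih =>
    rw [Fin.prod_univ_succ]
    by_cases h : A 0 0 = 0
    · rw [h, cls_zero, zero_mul]
      refine dieudonneDet_eq_zero fun k => ?_
      rcases eq_or_ne k 0 with rfl | hk
      · exact h
      · exact hA k 0 (Fin.pos_of_ne_zero hk)
    · rw [dieudonneDet_eq_schur h1 A 0 h, ih]
      · congr 1
        refine Finset.prod_congr rfl fun i _ => ?_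
        simp [schur, hA i.succ 0 (Fin.succ_pos i)]
      · intro i j hij
        simp [schur, hA i.succ 0 (Fin.succ_pos i), hA i.succ j.succ (Fin.succ_lt_succ_iff.mpr hij)]

end col

/-! ### Triangularization over the polynomials by column operations -/

section reduction

variable {K : Type*} [DivisionRing K] {n : ℕ}

/-- One step of the Euclidean algorithm. -/
theorem exists_degree_add_mul_lt {p q : K[X]} (hp : p ≠ 0) (h : p.natDegree ≤ q.natDegree)
    (hq : q ≠ 0) : ∃ c : K[X], (q + p * c).degree < q.degree := by
  -- `/ₘ` keeps the divisor on the left of the quotient, so normalizing `p` on the right makes what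
  -- is subtracted a right multiple of `p`.
  refine ⟨-(C p.leadingCoeff⁻¹ * (q /ₘ (p * C p.leadingCoeff⁻¹))), ?_⟩
  have hm : Monic (p * C p.leadingCoeff⁻¹) := monic_mul_leadingCoeff_inv hp
  have e : q + p * -(C p.leadingCoeff⁻¹ * (q /ₘ (p * C p.leadingCoeff⁻¹))) =
      q %ₘ (p * C p.leadingCoeff⁻¹) := by
    rw [modByMonic_eq_sub_mul_div, mul_neg, sub_eq_add_neg, mul_assoc]
  rw [e]
  refine (degree_modByMonic_lt q hm).trans_le ?_
  rw [degree_mul_leadingCoeff_inv _ hp, degree_eq_natDegree hp, degree_eq_natDegree hq]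
  exact_mod_cast h

/-- The column obtained by an operation. -/
def addCol {R : Type*} [Semiring R] (A : Matrix (Fin n) (Fin n) R) (i j : Fin n) (c : R) :
    Matrix (Fin n) (Fin n) R :=
  A.updateCol i fun r => A r i + A r j * c

theorem colOp_addCol {R : Type*} [Semiring R] (A : Matrix (Fin n) (Fin n) R) {i j : Fin n}
    (h : i ≠ j) (c : R) : ColOp A (addCol A i j c) :=
  ⟨i, j, c, h, fun r => by simp [addCol], fun r s hs => by simp [addCol, hs]⟩

/-- Column operations that clear the entries of the `r`-th row on the left of the diagonal and
leave the rows below unchanged, if these vanish up to the `r`-th column. -/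
theorem exists_clear_row (r : Fin n) (A : Matrix (Fin n) (Fin n) K[X])
    (hA : ∀ i j, r < i → j ≤ r → A i j = 0) :
    ∃ B, Relation.ReflTransGen ColOp A B ∧ (∀ j, j < r → B r j = 0) ∧
      ∀ i j, r < i → B i j = A i j := by
  classical
  -- The shift by one makes a vanishing entry count less than a nonzero constant.
  induction hN : ∑ j ∈ Finset.Iic r, (if A r j = 0 then 0 else (A r j).natDegree + 1)
    using Nat.strong_induction_on generalizing A with
  | _ N ih =>
  have low (i j : Fin n) (c : K[X]) (hi : i ≤ r) (hj : j ≤ r) (s t : Fin n) (hs : r < s) :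
      addCol A i j c s t = A s t := by
    rcases eq_or_ne t i with rfl | ht
    · simp [addCol, hA s j hs hj]
    · simp [addCol, ht]
  have wlog_step : ∀ p q : Fin n, p ≤ r → q ≤ r → q ≠ p → A r p ≠ 0 → A r q ≠ 0 →
      (A r p).natDegree ≤ (A r q).natDegree →
      ∃ B, Relation.ReflTransGen ColOp A B ∧ (∀ j, j < r → B r j = 0) ∧
        ∀ i j, r < i → B i j = A i j := by
    intro p q hp hq hqp h0p h0q hd
    obtain ⟨c, hc⟩ := exists_degree_add_mul_lt h0p hd h0q
    have hlt : ∑ j ∈ Finset.Iic r, (if addCol A q p c r j = 0 then 0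
        else (addCol A q p c r j).natDegree + 1) < N := by
      rw [← hN]
      refine Finset.sum_lt_sum (fun j _ => ?_) ⟨q, by simpa using hq, ?_⟩
      · rcases eq_or_ne j q with rfl | hj
        · simp only [addCol, Matrix.updateCol_self, if_neg h0q]
          split_ifs with h
          · simp
          · exact Nat.succ_le_succ (natDegree_le_natDegree hc.le)
        · simp [addCol, hj]
      · simp only [addCol, Matrix.updateCol_self, if_neg h0q]
        split_ifs with h
        · simp
        · exact Nat.succ_lt_succ (natDegree_lt_natDegree h hc)
    obtain ⟨B, h1, h2, h3⟩ := ih _ hlt (addCol A q p c)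
      (fun i j hi hj => by rw [low q p c hq hp i j hi, hA i j hi hj]) rfl
    exact ⟨B, .head (colOp_addCol A hqp c) h1, h2,
      fun i j hi => by rw [h3 i j hi, low q p c hq hp i j hi]⟩
  by_cases h : ∃ p, p < r ∧ A r p ≠ 0
  · obtain ⟨p, hp, h0⟩ := h
    by_cases h : ∃ q, q ≤ r ∧ q ≠ p ∧ A r q ≠ 0
    · obtain ⟨q, hq, hqp, h0q⟩ := h
      rcases le_total (A r p).natDegree (A r q).natDegree with hd | hd
      · exact wlog_step p q hp.le hq hqp h0 h0q hd
      · exact wlog_step q p hq hp.le hqp.symm h0q h0 hd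
    · push Not at h
      -- The only nonzero entry up to the diagonal is at `p < r`. Two column additions move it to
      -- the diagonal.
      have hr : A r r = 0 := h r le_rfl hp.ne'
      refine ⟨addCol (addCol A r p 1) p r (-1), .head (colOp_addCol A hp.ne' 1)
        (.single (colOp_addCol _ hp.ne (-1))), fun j hj => ?_, fun i j hi => ?_⟩
      · rcases eq_or_ne j p with rfl | hjp
        · simp [addCol, hj.ne, hr]
        · simp [addCol, hj.ne, hjp, h j hj.le hjp]
      · have e1 : addCol A r p 1 i r = 0 := by rw [low r p 1 le_rfl hp.le i r hi, hA i r hi le_rfl]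
        rcases eq_or_ne j p with rfl | hjp
        · rw [addCol, Matrix.updateCol_self, e1, zero_mul, add_zero,
            low r j 1 le_rfl hp.le i j hi]
        · rw [addCol, Matrix.updateCol_ne hjp, low r p 1 le_rfl hp.le i j hi]
  · push Not at h
    exact ⟨A, .refl, h, fun _ _ _ => rfl⟩

/-- Every square matrix of polynomials can be made upper triangular by column operations. -/
theorem exists_upperTriangular (A : Matrix (Fin n) (Fin n) K[X]) :
    ∃ B, Relation.ReflTransGen ColOp A B ∧ ∀ i j, j < i → B i j = 0 := by
  -- The last `k` rows are treated first, since clearing a row requires zeros below it.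
  have (k : ℕ) : ∃ B, Relation.ReflTransGen ColOp A B ∧
      ∀ i j : Fin n, n ≤ i + k → j < i → B i j = 0 := by
    induction k with
    | zero => exact ⟨A, .refl, fun i j h => by omega⟩
    | succ k ih =>
      obtain ⟨B, h1, h2⟩ := ih
      by_cases hk : k < n
      · obtain ⟨D, h3, h4, h5⟩ := exists_clear_row ⟨n - (k + 1), by omega⟩ B fun i j hi hj => by
          rw [Fin.lt_def] at hi
          rw [Fin.le_def] at hj
          exact h2 i j (by grind) (by grind)
        refine ⟨D, h1.trans h3, fun i j hi hj => ?_⟩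
        by_cases e : (i : ℕ) = n - (k + 1)
        · have hi' : i = ⟨n - (k + 1), by omega⟩ := Fin.ext e
          rw [hi'] at hj ⊢
          exact h4 j hj
        · rw [h5 i j (by rw [Fin.lt_def]; grind)]
          exact h2 i j (by omega) hj
      · exact ⟨B, h1, fun i j _ hj => h2 i j (by omega) hj⟩
  obtain ⟨B, h1, h2⟩ := this n
  exact ⟨B, h1, fun i j => h2 i j (by omega)⟩

end reduction

/-! ### Evaluation -/

theorem evalOne_eq_sum_range {R : ℍ[ℝ][X]} {N : ℕ} (h : R.natDegree < N) (q : ℍ[ℝ]) :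
    evalOne R q = ∑ n ∈ Finset.range N, q ^ n * R.coeff n :=
  R.sum_over_range' (fun n => by simp) N h

theorem evalOne_add (R S : ℍ[ℝ][X]) (q : ℍ[ℝ]) :
    evalOne (R + S) q = evalOne R q + evalOne S q :=
  sum_add_index R S _ (fun n => by simp) fun n a b => by simp [mul_add]

@[simp]
theorem evalOne_zero (q : ℍ[ℝ]) : evalOne 0 q = 0 := by simp [evalOne]

@[simp]
theorem evalOne_monomial (n : ℕ) (a q : ℍ[ℝ]) : evalOne (monomial n a) q = q ^ n * a := by
  simp [evalOne, sum_monomial_index]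

theorem evalOne_mul_monomial (R : ℍ[ℝ][X]) (n : ℕ) (a q : ℍ[ℝ]) :
    evalOne (R * monomial n a) q = q ^ n * evalOne R q * a := by
  induction R using Polynomial.induction_on' with
  | add R S hR hS => rw [add_mul, evalOne_add, evalOne_add, hR, hS, mul_add, add_mul]
  | monomial m b =>
    rw [monomial_mul_monomial, evalOne_monomial, evalOne_monomial, add_comm m, pow_add]
    noncomm_ring

/-- For commuting `a` and `b`, the tuples `c` of polynomials with `∑ aⁱ cᵢ(b) = 0` form a right
submodule. -/
theorem sum_evalOne_mul_eq_zero {n : ℕ} {a b : ℍ[ℝ]} (hab : a * b = b * a) {c : Fin n → ℍ[ℝ][X]}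
    (h : ∑ i : Fin n, a ^ (i : ℕ) * evalOne (c i) b = 0) (R : ℍ[ℝ][X]) :
    ∑ i : Fin n, a ^ (i : ℕ) * evalOne (c i * R) b = 0 := by
  induction R using Polynomial.induction_on' with
  | add R S hR hS => simp only [mul_add, evalOne_add, Finset.sum_add_distrib, hR, hS, add_zero]
  | monomial m x =>
    have (i : Fin n) : a ^ (i : ℕ) * evalOne (c i * monomial m x) b =
        b ^ m * (a ^ (i : ℕ) * evalOne (c i) b) * x := by
      rw [evalOne_mul_monomial, ← mul_assoc, ← mul_assoc, ((Commute.pow_pow hab _ _).eq),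
        mul_assoc (b ^ m)]
    simp only [this, ← Finset.sum_mul, ← Finset.mul_sum, h, mul_zero, zero_mul]

theorem evalOne_mul_eq_zero {R : ℍ[ℝ][X]} {b : ℍ[ℝ]} (h : evalOne R b = 0) (S : ℍ[ℝ][X]) :
    evalOne (R * S) b = 0 := by
  simpa using sum_evalOne_mul_eq_zero (n := 1) (a := b) (b := b) rfl (c := fun _ => R)
    (by simpa using h) S

/-- The value of the `*`-product at a point where the first factor does not vanish. -/
theorem evalOne_mul (R S : ℍ[ℝ][X]) {b : ℍ[ℝ]} (h : evalOne R b ≠ 0) :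
    evalOne (R * S) b = evalOne R b * evalOne S ((evalOne R b)⁻¹ * b * evalOne R b) := by
  induction S using Polynomial.induction_on' with
  | add S T hS hT => simp only [mul_add, evalOne_add, hS, hT]
  | monomial m x =>
    have e (m : ℕ) : evalOne R b * ((evalOne R b)⁻¹ * b * evalOne R b) ^ m =
        b ^ m * evalOne R b := by
      induction m with
      | zero => simp
      | succ m ih =>
        rw [pow_succ, ← mul_assoc, ih, pow_succ]
        simp [mul_assoc, h]
    rw [evalOne_mul_monomial, evalOne_monomial, ← mul_assoc, e]

theorem colOp_sum_eq_zero {n : ℕ} {a b : ℍ[ℝ]} (hab : a * b = b * a)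
    {A B : Matrix (Fin n) (Fin n) ℍ[ℝ][X]} (hAB : Relation.ReflTransGen ColOp A B)
    (h : ∀ j, ∑ i : Fin n, a ^ (i : ℕ) * evalOne (A i j) b = 0) (j : Fin n) :
    ∑ i : Fin n, a ^ (i : ℕ) * evalOne (B i j) b = 0 := by
  induction hAB generalizing j with
  | refl => exact h j
  | tail _ hop ih =>
    obtain ⟨i, k, c, -, h1, h2⟩ := hop
    rcases eq_or_ne j i with rfl | hj
    · simp only [h1, evalOne_add, mul_add, Finset.sum_add_distrib, ih,
        sum_evalOne_mul_eq_zero hab (ih k), add_zero]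
    · simp only [h2 _ j hj, ih]

/-! ### The inclusion of the polynomials in the skew field -/

theorem polyToSR_val (R : ℍ[ℝ][X]) (n : ℕ) :
    PowerSeries.coeff n (polyToSR R).1 = R.coeff n := by
  simp [polyToSR]

theorem polyToSR_injective : Function.Injective polyToSR := fun R S h => by
  ext1 n
  rw [← polyToSR_val, h, polyToSR_val]

/-- The inclusion of the polynomials in the slice regular functions as a ring homomorphism. -/
def polyToSRHom : ℍ[ℝ][X] →+* SR where
  toFun := polyToSR
  map_one' := Subtype.ext <| PowerSeries.ext fun n => by
    rw [polyToSR_val, Polynomial.coeff_one]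
    simp [PowerSeries.coeff_one]
  map_zero' := Subtype.ext <| PowerSeries.ext fun n => by
    rw [polyToSR_val]; simp
  map_add' R S := Subtype.ext <| PowerSeries.ext fun n => by
    rw [polyToSR_val, Subring.coe_add, map_add, polyToSR_val, polyToSR_val, coeff_add]
  map_mul' R S := Subtype.ext <| PowerSeries.ext fun n => by
    rw [polyToSR_val, Subring.coe_mul, PowerSeries.coeff_mul, Polynomial.coeff_mul]
    simp only [polyToSR_val]

/-- The inclusion of the polynomials in the skew field as a ring homomorphism. -/
def polyToLHom : ℍ[ℝ][X] →+* L :=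
  (OreLocalization.numeratorRingHom (R := SR) (S := nonZeroDivisors SR)).comp polyToSRHom

theorem polyToLHom_apply (R : ℍ[ℝ][X]) : polyToLHom R = polyToL R := rfl

theorem polyToL_eq_zero {R : ℍ[ℝ][X]} : polyToL R = 0 ↔ R = 0 := by
  refine ⟨fun h => ?_, fun h => by rw [← polyToLHom_apply, h, map_zero]⟩
  rw [← polyToLHom_apply, ← map_zero polyToLHom] at h
  exact polyToSR_injective (OreLocalization.numeratorHom_inj
    (S := nonZeroDivisors SR) inf_le_left h)

theorem cls_neg_one_L : cls (-1 : L) = 1 := by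
  obtain ⟨I, J, hIJ, h0⟩ : ∃ I J : ℍ[ℝ], I * J = -1 * (J * I) ∧ J * I ≠ 0 := by
    obtain ⟨I, hI⟩ : ∃ I : ℍ[ℝ], I = ⟨0, 1, 0, 0⟩ := ⟨_, rfl⟩
    obtain ⟨J, hJ⟩ : ∃ J : ℍ[ℝ], J = ⟨0, 0, 1, 0⟩ := ⟨_, rfl⟩
    refine ⟨I, J, ?_, fun h => ?_⟩
    · rw [neg_one_mul]
      ext <;> simp <;> simp [hI, hJ]
    · have := congrArg (·.imK) h
      simp at this
      simp [hI, hJ] at this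
  have e : polyToLHom (C I) * polyToLHom (C J) =
      -1 * (polyToLHom (C J) * polyToLHom (C I)) := by
    rw [← map_mul, ← C_mul, hIJ, C_mul, C_mul]
    simp
  have h0' : polyToLHom (C J) * polyToLHom (C I) ≠ 0 := by
    rw [← map_mul, ← C_mul, polyToLHom_apply, Ne, polyToL_eq_zero, C_eq_zero]
    exact h0
  have := congrArg cls e
  rw [cls_mul (-1), cls_mul, cls_mul, mul_comm] at this
  rw [← cls_mul] at this
  exact (mul_eq_right₀ (cls_ne_zero h0')).mp this.symm

/-- The determinant of a matrix of polynomials has a polynomial representative that vanishes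
at `b` whenever all the columns `c` satisfy `∑ aⁱ cᵢ(b) = 0`. -/
theorem exists_isPolyRep_dieudonneDet {n : ℕ} (hn : 0 < n)
    (A : Matrix (Fin n) (Fin n) ℍ[ℝ][X]) :
    ∃ R : ℍ[ℝ][X], IsPolyRep R (dieudonneDet n (A.map polyToL)) ∧
      ∀ a b : ℍ[ℝ], a * b = b * a → (∀ j, ∑ i : Fin n, a ^ (i : ℕ) * evalOne (A i j) b = 0) →
        evalOne R b = 0 := by
  obtain ⟨n, rfl⟩ := Nat.exists_eq_succ_of_ne_zero hn.ne'
  obtain ⟨B, hAB, hB⟩ := exists_upperTriangular A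
  -- The order matters: `B 0 0`, which will vanish at `b`, must be the leftmost factor.
  refine ⟨(List.ofFn fun i => B i i).prod, ?_, fun a b hab h => ?_⟩
  · have hdet : dieudonneDet (n + 1) (B.map polyToL) = dieudonneDet (n + 1) (A.map polyToL) := by
      clear hB
      induction hAB with
      | refl => rfl
      | tail _ hop ih =>
        rw [← ih]
        exact (hop.map polyToLHom).dieudonneDet_eq cls_neg_one_L
    rw [IsPolyRep, ← hdet, dieudonneDet_of_upperTriangular cls_neg_one_L]
    · have := map_list_prod ((clsHom L).comp polyToLHom.toMonoidHom) (List.ofFn fun i => B i i)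
      rw [List.map_ofFn, List.prod_ofFn] at this
      exact this
    · intro i j hij
      rw [Matrix.map_apply, hB i j hij, polyToL_eq_zero]
  · have h0 := colOp_sum_eq_zero hab hAB h 0
    rw [Finset.sum_eq_single 0 (fun i _ hi => by
      rw [hB i 0 (Fin.pos_of_ne_zero hi), evalOne_zero, mul_zero]) (by simp)] at h0
    rw [List.ofFn_succ, List.prod_cons]
    exact evalOne_mul_eq_zero (by simpa using h0) _

/-! ### The norm on the skew field -/

theorem conjSR_mul (f g : SR) : conjSR (f * g) = conjSR g * conjSR f :=
  Subtype.ext (regConj_mul f.1 g.1)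

/-- The symmetrization `f ↦ fˢ = f^c * f` as a homomorphism to the center. -/
def normSR : SR →* Subring.center SR where
  toFun f := ⟨conjSR f * f, Subring.mem_center_iff.mpr fun g => (symm_mul_comm f g).symm⟩
  map_one' := Subtype.ext <| by
    change conjSR 1 * 1 = 1
    rw [mul_one]
    refine Subtype.ext (PowerSeries.ext fun n => ?_)
    change PowerSeries.coeff n (regConj 1) = PowerSeries.coeff n 1
    simp only [regConj, PowerSeries.coeff_mk, PowerSeries.coeff_one]
    split_ifs <;> simp
  map_mul' f g := Subtype.ext <| by
    change conjSR (f * g) * (f * g) = conjSR f * f * (conjSR g * g)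
    rw [conjSR_mul, symm_mul_comm f, mul_assoc, ← mul_assoc _ f g, symm_mul_comm f g, ← mul_assoc]

theorem normSR_ne_zero {f : SR} (hf : f ≠ 0) : normSR f ≠ 0 := fun h =>
  mul_ne_zero (conjSR_ne_zero hf) hf (congrArg Subtype.val h)

/-- The symmetrization with values in the field of fractions of the center. -/
def normFrac : SR →* FractionRing (Subring.center SR) :=
  (algebraMap (Subring.center SR) (FractionRing (Subring.center SR))).toMonoidHom.comp normSR

theorem normFrac_ne_zero (f : nonZeroDivisors SR) : normFrac f ≠ 0 := fun h =>
  normSR_ne_zero (nonZeroDivisors.ne_zero f.2)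
    (IsFractionRing.injective (Subring.center SR) (FractionRing (Subring.center SR))
      (h.trans (map_zero _).symm))

/-- The norm on the skew field of semi-regular functions. -/
def normL : L →* FractionRing (Subring.center SR) :=
  OreLocalization.universalMulHom normFrac
    (Units.liftRight (normFrac.comp (nonZeroDivisors SR).subtype)
      (fun f => Units.mk0 (normFrac f) (normFrac_ne_zero f)) fun _ => rfl) fun _ => rfl

theorem normL_polyToL (R : ℍ[ℝ][X]) : normL (polyToL R) = normFrac (polyToSR R) :=
  OreLocalization.universalMulHom_commutes _ _ _

/-- On units, a homomorphism to a commutative monoid factors through the abelianization; the class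
`0` contains only `0`. -/
theorem map_eq_of_cls_eq {F M : Type*} [DivisionRing F] [CommMonoid M] (f : F →* M) {x y : F}
    (h : cls x = cls y) : f x = f y := by
  by_cases hx : x = 0
  · rw [hx, cls_zero, eq_comm, cls_eq_zero] at h
    rw [hx, h]
  by_cases hy : y = 0
  · rw [hy, cls_zero, cls_eq_zero] at h
    rw [hy, h]
  simp only [cls, hx, hy, dif_neg, not_false_eq_true, WithZero.coe_inj] at h
  have := congrArg (Abelianization.lift (Units.map f)) h
  rw [Abelianization.lift_apply_of, Abelianization.lift_apply_of] at this
  simpa using congrArg Units.val this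

/-- The regular conjugate of a polynomial. -/
def conjPoly (R : ℍ[ℝ][X]) : ℍ[ℝ][X] :=
  ∑ n ∈ Finset.range (R.natDegree + 1), monomial n (star (R.coeff n))

theorem conjPoly_coeff (R : ℍ[ℝ][X]) (n : ℕ) : (conjPoly R).coeff n = star (R.coeff n) := by
  rw [conjPoly, finsetSum_coeff]
  simp only [coeff_monomial, Finset.sum_ite_eq', Finset.mem_range]
  split_ifs with h
  · rfl
  · rw [coeff_eq_zero_of_natDegree_lt (by omega), star_zero]

theorem polyToSR_conjPoly (R : ℍ[ℝ][X]) : polyToSR (conjPoly R) = conjSR (polyToSR R) := by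
  refine Subtype.ext (PowerSeries.ext fun n => ?_)
  rw [polyToSR_val, conjPoly_coeff]
  simp [conjSR, regConj, polyToSR_val]

theorem conjPoly_mul_comm (R S : ℍ[ℝ][X]) : conjPoly R * R * S = S * (conjPoly R * R) := by
  apply polyToSR_injective
  change polyToSRHom _ = polyToSRHom _
  simp only [map_mul]
  change polyToSR (conjPoly R) * polyToSR R * polyToSR S =
    polyToSR S * (polyToSR (conjPoly R) * polyToSR R)
  rw [polyToSR_conjPoly, symm_mul_comm]

theorem mul_conjPoly (R : ℍ[ℝ][X]) : R * conjPoly R = conjPoly R * R := by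
  by_cases h : R = 0
  · simp [h]
  -- Both sides times `R` agree because `conjPoly R * R` is central.
  refine mul_right_cancel₀ h ?_
  rw [conjPoly_mul_comm, mul_assoc]

theorem conjPoly_mul_eq_of_cls_eq {R S : ℍ[ℝ][X]} (h : cls (polyToL R) = cls (polyToL S)) :
    conjPoly R * R = conjPoly S * S := by
  have h1 := map_eq_of_cls_eq normL h
  rw [normL_polyToL, normL_polyToL] at h1
  have h2 := congrArg Subtype.val (IsFractionRing.injective (Subring.center SR)
    (FractionRing (Subring.center SR)) h1)
  change conjSR (polyToSR R) * polyToSR R = conjSR (polyToSR S) * polyToSR S at h2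
  rw [← polyToSR_conjPoly, ← polyToSR_conjPoly] at h2
  apply polyToSR_injective
  change polyToSRHom _ = polyToSRHom _
  rw [map_mul, map_mul]
  exact h2

/-! ### Zeros on a sphere of conjugates -/

theorem sq_eq (c : ℍ[ℝ]) : c * c = ((2 * c.re : ℝ) : ℍ[ℝ]) * c - ((normSq c : ℝ) : ℍ[ℝ]) := by
  ext <;> simp <;> (try rw [normSq_def']) <;> ring

/-- All points of a sphere satisfy the same real quadratic equation, so the same real coefficients
reduce their powers. Hence a polynomial restricts to `c ↦ c * α + β` on the sphere. -/
theorem exists_pow_eq (x y : ℝ) : ∃ s t : ℕ → ℝ, ∀ c : ℍ[ℝ], c.re = x → normSq c = y →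
    ∀ n, c ^ n = c * s n + t n := by
  obtain ⟨z, hz⟩ : ∃ z, z = 2 * x := ⟨_, rfl⟩
  obtain ⟨p, p0, hp⟩ : ∃ p : ℕ → ℝ × ℝ, p 0 = (0, 1) ∧
      ∀ n, p (n + 1) = ((p n).2 + z * (p n).1, -(y * (p n).1)) :=
    ⟨fun n => Nat.rec (0, 1) (fun _ q => (q.2 + z * q.1, -(y * q.1))) n, rfl, fun _ => rfl⟩
  refine ⟨fun n => (p n).1, fun n => (p n).2, fun c hx hy n => ?_⟩
  induction n with
  | zero => simp [p0]
  | succ n ih =>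
    rw [pow_succ', ih, mul_add, ← mul_assoc, sq_eq, hx, hy, ← hz, coe_commutes z c]
    simp only [hp, Quaternion.coe_add, Quaternion.coe_neg, Quaternion.coe_mul]
    noncomm_ring

/-- Quaternions with the same real part and the same norm are conjugate. -/
theorem exists_conj_eq {b c : ℍ[ℝ]} (h1 : c.re = b.re) (h2 : normSq c = normSq b) :
    ∃ u : ℍ[ℝ], u ≠ 0 ∧ c = u * b * u⁻¹ := by
  suffices ∃ u : ℍ[ℝ], u ≠ 0 ∧ c * u = u * b by
    obtain ⟨u, hu, h⟩ := this
    exact ⟨u, hu, by rw [← h, mul_inv_cancel_right₀ hu]⟩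
  -- Each `c * v - v * star b` intertwines `b` and `c`. If all of them vanish, `v = 1, i, j` force
  -- `c = star b` with `b` real, so `c = b`.
  have key (v : ℍ[ℝ]) : c * (c * v - v * star b) = (c * v - v * star b) * b := by
    have e : star b = ((2 * b.re : ℝ) : ℍ[ℝ]) - b := by ext <;> simp; ring
    have e2 : star b * b = ((normSq b : ℝ) : ℍ[ℝ]) := star_mul_self b
    rw [mul_sub, sub_mul, mul_assoc v, e2, ← mul_assoc, sq_eq, h1, h2, e, sub_mul,
      mul_sub, mul_sub, coe_commutes (2 * b.re) c, coe_commutes (normSq b) v,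
      mul_assoc c, coe_commutes (2 * b.re) v, mul_assoc]
    abel
  by_contra! H
  have hz (v : ℍ[ℝ]) : c * v - v * star b = 0 := by_contra fun h => H _ h (key v)
  have e1 : c = star b := by simpa [sub_eq_zero] using hz 1
  obtain ⟨I, hI⟩ : ∃ I : ℍ[ℝ], I = ⟨0, 1, 0, 0⟩ := ⟨_, rfl⟩
  obtain ⟨J, hJ⟩ : ∃ J : ℍ[ℝ], J = ⟨0, 0, 1, 0⟩ := ⟨_, rfl⟩
  have e2 := hz I
  have e3 := hz J
  rw [e1] at e2 e3
  have bJ : b.imJ = 0 := by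
    have := congrArg (·.imK) e2
    simp at this
    simp [hI] at this
    linarith
  have bK : b.imK = 0 := by
    have := congrArg (·.imJ) e2
    simp at this
    simp [hI] at this
    linarith
  have bI : b.imI = 0 := by
    have := congrArg (·.imK) e3
    simp at this
    simp [hJ] at this
    linarith
  refine H 1 one_ne_zero ?_
  rw [e1, mul_one, one_mul]
  ext <;> simp [bI, bJ, bK]

theorem re_conj {u : ℍ[ℝ]} (hu : u ≠ 0) (b : ℍ[ℝ]) : (u * b * u⁻¹).re = b.re := by
  have (x y : ℍ[ℝ]) : (x * y).re = (y * x).re := by simp; ring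
  rw [this, inv_mul_cancel_left₀ hu]

theorem normSq_conj {u : ℍ[ℝ]} (hu : u ≠ 0) (b : ℍ[ℝ]) : normSq (u * b * u⁻¹) = normSq b := by
  rw [map_mul, map_mul, mul_right_comm, ← map_mul, mul_inv_cancel₀ hu, map_one, one_mul]

/-- If the symmetrization of `R` vanishes at `b`, then `R` vanishes at a conjugate of `b`. -/
theorem exists_evalOne_conj_eq_zero {R : ℍ[ℝ][X]} {b : ℍ[ℝ]}
    (h : evalOne (conjPoly R * R) b = 0) :
    ∃ u : ℍ[ℝ], u ≠ 0 ∧ evalOne R (u * b * u⁻¹) = 0 := by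
  obtain ⟨s, t, hst⟩ := exists_pow_eq b.re (normSq b)
  set N := max R.natDegree (conjPoly R).natDegree + 1
  set α : ℍ[ℝ] := ∑ n ∈ Finset.range N, s n * R.coeff n with hα
  set β : ℍ[ℝ] := ∑ n ∈ Finset.range N, t n * R.coeff n with hβ
  have hR (c : ℍ[ℝ]) (h1 : c.re = b.re) (h2 : normSq c = normSq b) :
      evalOne R c = c * α + β := by
    rw [evalOne_eq_sum_range (N := N) (by simp [N]), hα, hβ, Finset.mul_sum,
      ← Finset.sum_add_distrib]
    exact Finset.sum_congr rfl fun n _ => by rw [hst c h1 h2, add_mul, mul_assoc]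
  have hRc (c : ℍ[ℝ]) (h1 : c.re = b.re) (h2 : normSq c = normSq b) :
      evalOne (conjPoly R) c = c * star α + star β := by
    rw [evalOne_eq_sum_range (N := N) (by simp [N]), hα, hβ, star_sum, star_sum,
      Finset.mul_sum, ← Finset.sum_add_distrib]
    refine Finset.sum_congr rfl fun n _ => ?_
    rw [hst c h1 h2, add_mul, mul_assoc, conjPoly_coeff, star_mul, star_mul, star_coe, star_coe,
      coe_commutes, coe_commutes]
  by_cases hb : evalOne R b = 0
  · exact ⟨1, one_ne_zero, by simpa using hb⟩
  have hb' : (evalOne R b)⁻¹ ≠ 0 := inv_ne_zero hb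
  set c : ℍ[ℝ] := (evalOne R b)⁻¹ * b * evalOne R b with hc
  have hc' : c = (evalOne R b)⁻¹ * b * (evalOne R b)⁻¹⁻¹ := by rw [inv_inv]
  have c1 : c.re = b.re := by rw [hc', re_conj hb']
  have c2 : normSq c = normSq b := by rw [hc', normSq_conj hb']
  -- The regular conjugate vanishes at `c`. Conjugating this gives `α * star c + β = 0`, so `α *
  -- star c * α⁻¹` is a zero of `R` on the sphere of `b`.
  rw [← mul_conjPoly, evalOne_mul R _ hb, mul_eq_zero, or_iff_right hb, ← hc, hRc c c1 c2] at h
  have h' : α * star c + β = 0 := by simpa using congrArg star h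
  have hα0 : α ≠ 0 := fun h0 => hb <| by
    rw [h0, zero_mul, zero_add] at h'
    rw [hR b rfl rfl, h0, h', mul_zero, zero_add]
  have d1 : (α * star c * α⁻¹).re = b.re := by rw [re_conj hα0, re_star, c1]
  have d2 : normSq (α * star c * α⁻¹) = normSq b := by rw [normSq_conj hα0, normSq_star, c2]
  obtain ⟨u, hu, hd⟩ := exists_conj_eq d1 d2
  refine ⟨u, hu, ?_⟩
  rw [← hd, hR _ d1 d2, inv_mul_cancel_right₀ hα0, h']

/-- All polynomial representatives of a class vanish on the same spheres of conjugates. -/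
theorem IsPolyRep.exists_conj_eq_zero {R S : ℍ[ℝ][X]} {x : AbQuot L} (hR : IsPolyRep R x)
    (hS : IsPolyRep S x) {b : ℍ[ℝ]} (hb : evalOne S b = 0) :
    ∃ u : ℍ[ℝ], u ≠ 0 ∧ evalOne R (u * b * u⁻¹) = 0 := by
  refine exists_evalOne_conj_eq_zero ?_
  rw [conjPoly_mul_eq_of_cls_eq (hR.trans hS.symm), ← mul_conjPoly]
  exact evalOne_mul_eq_zero hb _

/-! ### Sylvester matrices -/

theorem evalTwo_add (P Q : ℍ[ℝ][X][X]) (a b : ℍ[ℝ]) :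
    evalTwo (P + Q) a b = evalTwo P a b + evalTwo Q a b :=
  sum_add_index P Q (fun n p => a ^ n * evalOne p b) (fun n => by simp)
    fun n p q => by simp [mul_add, evalOne_add]

theorem evalTwo_monomial (n : ℕ) (p : ℍ[ℝ][X]) (a b : ℍ[ℝ]) :
    evalTwo (monomial n p) a b = a ^ n * evalOne p b :=
  sum_monomial_index p (fun n p => a ^ n * evalOne p b) (by simp)

theorem swapVars_add (P Q : ℍ[ℝ][X][X]) : swapVars (P + Q) = swapVars P + swapVars Q := by
  refine sum_add_index P Q _ (fun n => by simp) fun n p q => ?_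
  exact sum_add_index p q _ (fun n => by simp) fun n x y => by simp

theorem swapVars_monomial (n m : ℕ) (x : ℍ[ℝ]) :
    swapVars (monomial n (monomial m x)) = monomial m (monomial n x) := by
  simp [swapVars, sum_monomial_index]

theorem evalTwo_swapVars (P : ℍ[ℝ][X][X]) {a b : ℍ[ℝ]} (hab : a * b = b * a) :
    evalTwo (swapVars P) b a = evalTwo P a b := by
  induction P using Polynomial.induction_on' with
  | add P Q hP hQ => rw [swapVars_add, evalTwo_add, evalTwo_add, hP, hQ]
  | monomial n p =>
    induction p using Polynomial.induction_on' with
    | add p q hp hq => rw [map_add, swapVars_add, evalTwo_add, evalTwo_add, hp, hq]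
    | monomial m x =>
      rw [swapVars_monomial, evalTwo_monomial, evalTwo_monomial, evalOne_monomial,
        evalOne_monomial, ← mul_assoc, ← mul_assoc, (Commute.pow_pow hab n m).eq]

theorem IsCommutingCommonZero.swapVars {P Q : ℍ[ℝ][X][X]} {a b : ℍ[ℝ]}
    (h : IsCommutingCommonZero P Q a b) :
    IsCommutingCommonZero (swapVars P) (swapVars Q) b a :=
  ⟨h.1.symm, by rw [evalTwo_swapVars P h.1, h.2.1], by rw [evalTwo_swapVars Q h.1, h.2.2]⟩

/-- Row `i` of the shifted column holds the coefficient of index `i - j`, and its weight splits as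
`aⁱ = aʲ aⁱ⁻ʲ`. -/
theorem sum_shift_eq (P : ℍ[ℝ][X][X]) (a b : ℍ[ℝ]) {N j : ℕ} (h : j + P.natDegree < N) :
    ∑ i : Fin N, a ^ (i : ℕ) * evalOne
      (if (i : ℕ) ∈ Set.Icc j (j + P.natDegree) then P.coeff (i - j) else 0) b =
    a ^ j * evalTwo P a b := by
  have e : evalTwo P a b = ∑ n ∈ Finset.range (P.natDegree + 1), a ^ n * evalOne (P.coeff n) b :=
    P.sum_over_range (f := fun n p => a ^ n * evalOne p b) (fun n => by simp)
  rw [e, Fin.sum_univ_eq_sum_range (fun i => a ^ i * evalOne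
      (if i ∈ Set.Icc j (j + P.natDegree) then P.coeff (i - j) else 0) b) N,
    ← Finset.sum_subset (s₁ := Finset.Ico j (j + P.natDegree + 1)), Finset.sum_Ico_eq_sum_range,
    Finset.mul_sum, show j + P.natDegree + 1 - j = P.natDegree + 1 by omega]
  · refine Finset.sum_congr rfl fun n hn => ?_
    rw [Finset.mem_range] at hn
    rw [if_pos ⟨by omega, by omega⟩, pow_add, mul_assoc, Nat.add_sub_cancel_left]
  · intro i hi
    rw [Finset.mem_Ico] at hi
    rw [Finset.mem_range]
    omega
  · intro i _ hi
    rw [Finset.mem_Ico] at hi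
    rw [if_neg (fun h => hi ⟨h.1, Nat.lt_succ_of_le h.2⟩), evalOne_zero, mul_zero]

theorem sum_sylvester_eq_zero {P Q : ℍ[ℝ][X][X]} {a b : ℍ[ℝ]}
    (h : IsCommutingCommonZero P Q a b) (j : Fin (Q.natDegree + P.natDegree)) :
    ∑ i : Fin _, a ^ (i : ℕ) * evalOne (sylvester Q P Q.natDegree P.natDegree i j) b = 0 := by
  induction j using Fin.addCases with
  | left j =>
    simp only [sylvester, Matrix.of_apply, Fin.addCases_left]
    rw [sum_shift_eq P a b (j := j) (by omega), h.2.1, mul_zero]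
  | right j =>
    simp only [sylvester, Matrix.of_apply, Fin.addCases_right]
    rw [sum_shift_eq Q a b (j := j) (by omega), h.2.2, mul_zero]

theorem exists_isPolyRep_res (P Q : ℍ[ℝ][X][X]) (h : 0 < deg₁ P + deg₁ Q) :
    ∃ R : ℍ[ℝ][X], IsPolyRep R (res₁ P Q) ∧
      ∀ a b : ℍ[ℝ], IsCommutingCommonZero P Q a b → evalOne R b = 0 := by
  obtain ⟨R, h1, h2⟩ := exists_isPolyRep_dieudonneDet (n := deg₁ Q + deg₁ P) (by omega)
    (sylvester Q P (deg₁ Q) (deg₁ P))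
  exact ⟨R, h1, fun a b hab => h2 a b hab.1 (sum_sylvester_eq_zero hab)⟩

end SliceRegular

end


open SliceRegular in
theorem corollary4p5 (P Q : ℍ[ℝ][X][X]) :
    (0 < deg₁ P + deg₁ Q →
      (∃ R : ℍ[ℝ][X], IsPolyRep R (res₁ P Q) ∧
        ∀ a b : ℍ[ℝ], IsCommutingCommonZero P Q a b → evalOne R b = 0) ∧
      (∀ R : ℍ[ℝ][X], IsPolyRep R (res₁ P Q) →
        ∀ a b : ℍ[ℝ], IsCommutingCommonZero P Q a b →
          ∃ u : ℍ[ℝ], u ≠ 0 ∧ evalOne R (u * b * u⁻¹) = 0)) ∧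
    (0 < deg₂ P + deg₂ Q →
      (∃ R : ℍ[ℝ][X], IsPolyRep R (res₂ P Q) ∧
        ∀ a b : ℍ[ℝ], IsCommutingCommonZero P Q a b → evalOne R a = 0) ∧
      (∀ R : ℍ[ℝ][X], IsPolyRep R (res₂ P Q) →
        ∀ a b : ℍ[ℝ], IsCommutingCommonZero P Q a b →
          ∃ u : ℍ[ℝ], u ≠ 0 ∧ evalOne R (u * a * u⁻¹) = 0)) := by
  refine ⟨fun h => ?_, fun h => ?_⟩
  · obtain ⟨R, h1, h2⟩ := exists_isPolyRep_res P Q h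
    exact ⟨⟨R, h1, h2⟩, fun S hS a b hab => hS.exists_conj_eq_zero h1 (h2 a b hab)⟩
  -- By definition `res₂ P Q` is `res₁` of the swapped polynomials.
  · obtain ⟨R, h1, h2⟩ := exists_isPolyRep_res (swapVars P) (swapVars Q) h
    exact ⟨⟨R, h1, fun a b hab => h2 b a hab.swapVars⟩,
      fun S hS a b hab => hS.exists_conj_eq_zero h1 (h2 b a hab.swapVars)⟩
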